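/- All graphs are finite, simple and have at least one vertex; $\alpha(H)$ denotes the independence number of a graph $H$, and $\Delta_H$ its independence complex, i.e. the simplicial complex on $V(H)$ whose faces are the independent sets of vertices of $H$. A graph $H$ is called \emph{shellable} if the facets of $\Delta_H$ can be ordered as $F_1,\dots,F_m$ so that for all $1\le i<j\le m$ there exist $v\in F_j\setminus F_i$ and $\ell<j$ with $F_j\setminus F_\ell=\{v\}$. For a field $k$, a graph $H$ is called \emph{Cohen--Macaulay over $k$} if the Stanley--Reisner ring $k[\Delta_H]$ is a Cohen--Macaulay ring. For a graph $G$ and a family $\mathcal H=\{H_x\mid x\in V(G)\}$ of graphs, the lexicographic product $G[\mathcal H]$ is the graph with vertices the pairs $(x,y)$, $x\in V(G)$, $y\in V(H_x)$, in which $(x,y)$ and $(x',y')$ are adjacent if either $x=x'$ and $y$ is adjacent to $y'$ in $H_x$, or $x$ is adjacent to $x'$ in $G$. Let $k$ be a field, let $G$ be a complete graph with $n\ge 1$ vertices, and let $\mathcal H=\{H_x\mid x\in V(G)\}$ be a family of shellable graphs that are Cohen--Macaulay over $k$, such that $H_x$ is complete for at least $n-1$ of the vertices $x$ of $G$, and $\alpha(H_x)=\alpha(H_y)$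 for all $x,y\in V(G)$. Then $G[\mathcal H]$ is Cohen--Macaulay over $k$. -/

import Mathlib

namespace AbstractSimplicialComplex

/-- A facet is a maximal face. (Faces in `AbstractSimplicialComplex` are the nonempty ones.) -/
def IsFacet {V : Type*} (Δ : AbstractSimplicialComplex V) (s : Finset V) : Prop :=
  Maximal (fun t => t ∈ Δ.faces) s

/-- (Nonpure) shellability: the facets can be listed without repetition as `F 0, …, F (m - 1)`
such that for all `i < j` there are `v ∈ F j \ F i` and `l < j` with `F j \ F l = {v}`. -/
def IsShellable {V : Type*} (Δ : AbstractSimplicialComplex V) : Prop :=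
  ∃ (m : ℕ) (F : Fin m → Finset V), Function.Injective F ∧ (∀ s, Δ.IsFacet s ↔ ∃ i, F i = s) ∧
    ∀ i j, i < j → ∃ v, v ∈ F j ∧ v ∉ F i ∧ ∃ l, l < j ∧ (F j : Set V) \ (F l : Set V) = {v}

/-- The Stanley–Reisner ideal, generated by the squarefree monomials of the non-faces.
The empty set counts as a face in the usual convention, so it gives no generator. -/
noncomputable def stanleyReisnerIdeal {V : Type*} (k : Type*) [Field k] (Δ : AbstractSimplicialComplex V) :
    Ideal (MvPolynomial V k) :=
  Ideal.span {p | ∃ s : Finset V, s.Nonempty ∧ s ∉ Δ.faces ∧ p = ∏ x ∈ s, MvPolynomial.X x}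

/-- The Stanley–Reisner ring `k[Δ]`. -/
abbrev StanleyReisnerRing {V : Type*} (k : Type*) [Field k] (Δ : AbstractSimplicialComplex V) :
    Type _ :=
  MvPolynomial V k ⧸ Δ.stanleyReisnerIdeal k

end AbstractSimplicialComplex

/-- The depth of a local ring: the supremum of the lengths of regular sequences contained in the
maximal ideal. -/
noncomputable def localRingDepth (R : Type*) [CommRing R] [IsLocalRing R] : ℕ∞ :=
  ⨆ (rs : List R) (_ : RingTheory.Sequence.IsRegular R rs ∧
    ∀ r ∈ rs, r ∈ IsLocalRing.maximalIdeal R), (rs.length : ℕ∞)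

/-- A Cohen–Macaulay ring: a Noetherian ring whose localization at each maximal ideal has depth
equal to its Krull dimension. -/
def IsCohenMacaulayRing (R : Type*) [CommRing R] : Prop :=
  IsNoetherianRing R ∧ ∀ (m : Ideal R) [m.IsMaximal],
    (localRingDepth (Localization.AtPrime m) : WithBot ℕ∞) =
      ringKrullDim (Localization.AtPrime m)

namespace SimpleGraph

/-- The independence complex: its faces are the (nonempty, finite) independent sets. -/
def independenceComplex {V : Type*} (G : SimpleGraph V) : AbstractSimplicialComplex V where
  faces := {s | s.Nonempty ∧ G.IsIndepSet (s : Set V)}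
  isRelLowerSet_faces := fun _ hs =>
    ⟨hs.1, fun _ hts ht => ⟨ht, hs.2.mono (Finset.coe_subset.mpr hts)⟩⟩
  singleton_mem v := ⟨Finset.singleton_nonempty v, by simp⟩

/-- A graph is shellable if its independence complex is. -/
def IsShellable {V : Type*} (G : SimpleGraph V) : Prop :=
  G.independenceComplex.IsShellable

/-- A graph is Cohen–Macaulay over `k` if the Stanley–Reisner ring over `k` of its independence
complex is Cohen–Macaulay. -/
def IsCohenMacaulay {V : Type*} (k : Type*) [Field k] (G : SimpleGraph V) : Prop :=
  IsCohenMacaulayRing (G.independenceComplex.StanleyReisnerRing k)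

/-- The lexicographic product `G[ℋ]` of a graph with a family of graphs indexed by its vertices. -/
def lexProduct {V : Type*} (G : SimpleGraph V) {W : V → Type*} (H : ∀ x, SimpleGraph (W x)) :
    SimpleGraph (Σ x, W x) where
  Adj p q := (∃ h : p.1 = q.1, (H q.1).Adj (h ▸ p.2) q.2) ∨ G.Adj p.1 q.1
  symm := ⟨by
    rintro ⟨x, y⟩ ⟨x', y'⟩ (⟨h, hadj⟩ | hadj)
    · dsimp only at h
      subst h
      exact Or.inl ⟨rfl, hadj.symm⟩
    · exact Or.inr hadj.symm⟩
  loopless := ⟨by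
    rintro ⟨x, y⟩ (⟨_, hadj⟩ | hadj)
    · exact (H x).irrefl hadj
    · exact G.irrefl hadj⟩

end SimpleGraph

/-! If `G` has one vertex, the product is isomorphic to its only factor. Otherwise some factor is
complete, so the common independence number is 1; then every factor is complete, and so is the
product.

It remains to treat a complete graph. Its Stanley–Reisner ring is the coordinate ring of the union
of the coordinate axes. It is integral over `k[t]` via `t ↦ ∑ X i`, and nonzero polynomials in `t`
become nonzerodivisors. Hence each maximal ideal contains a nonzerodivisor coming from `k[t]`, and
all primes above that element are maximal. So each localization at a maximal ideal has dimension at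
most 1 and depth at least 1, and depth never exceeds dimension. -/

open IsLocalRing RingTheory.Sequence in
/-- A Noetherian local ring of dimension at most one whose maximal ideal contains a
nonzerodivisor has depth equal to its dimension. -/
theorem localRingDepth_eq_ringKrullDim_of_le_one {R : Type*} [CommRing R] [IsLocalRing R]
    [IsNoetherianRing R] (hdim : ringKrullDim R ≤ 1) {x : R} (hx : x ∈ maximalIdeal R)
    (hreg : x ∈ nonZeroDivisors R) : (localRingDepth R : WithBot ℕ∞) = ringKrullDim R := by
  -- Cutting by a regular sequence lowers the dimension by its length, and the nonzero quotient has
  -- dimension at least 0.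
  have length_le (rs : List R) (h : IsRegular R rs) :
      ((rs.length : ℕ∞) : WithBot ℕ∞) ≤ ringKrullDim R := by
    have hnt : Nontrivial (R ⧸ Ideal.ofList rs) :=
      Ideal.Quotient.nontrivial_iff.mpr fun htop => h.top_ne_smul (by simp [htop])
    rw [← ringKrullDim_add_length_eq_ringKrullDim_of_isRegular rs h]
    exact le_add_of_nonneg_left ringKrullDim_nonneg_of_nontrivial
  have hx' : ∀ r ∈ [x], r ∈ maximalIdeal R := by simpa using hx
  have hone : IsRegular R [x] := by
    refine IsRegular.of_isWeaklyRegular_of_mem_maximalIdeal R hx' ?_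
    rw [isWeaklyRegular_singleton_iff]
    exact (isRegular_iff_mem_nonZeroDivisors.mpr hreg).left
  have hdim' : ringKrullDim R = 1 := le_antisymm hdim (by simpa using length_le [x] hone)
  have hdepth : localRingDepth R = 1 := by
    refine le_antisymm (iSup₂_le fun rs h => ?_) ?_
    · exact WithBot.coe_le_coe.mp ((length_le rs h.1).trans hdim)
    · exact le_iSup₂_of_le [x] ⟨hone, hx'⟩ (by simp)
  rw [hdim', hdepth]
  rfl

/-- A Noetherian ring is Cohen–Macaulay if each maximal ideal contains a nonzerodivisor
all of whose prime overideals are maximal. -/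
theorem IsCohenMacaulayRing.of_exists_nonZeroDivisor {R : Type*} [CommRing R] [IsNoetherianRing R]
    (h : ∀ m : Ideal R, m.IsMaximal → ∃ f ∈ m, f ∈ nonZeroDivisors R ∧
      ∀ p : Ideal R, p.IsPrime → f ∈ p → p.IsMaximal) : IsCohenMacaulayRing R := by
  refine ⟨inferInstance, fun m hm => ?_⟩
  obtain ⟨f, hfm, hf, hmax⟩ := h m hm
  have hzero : ringKrullDim (R ⧸ Ideal.span {f}) ≤ 0 := by
    have : Ring.KrullDimLE 0 (R ⧸ Ideal.span {f}) := Ring.KrullDimLE.mk₀ fun I hI => by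
      have hc := hmax (I.comap (Ideal.Quotient.mk _)) inferInstance (by
        rw [Ideal.mem_comap, Ideal.Quotient.eq_zero_iff_mem.mpr (Ideal.mem_span_singleton_self f)]
        exact I.zero_mem)
      rw [← Ideal.map_comap_of_surjective _ Ideal.Quotient.mk_surjective I]
      refine (Ideal.map_eq_top_or_isMaximal_of_surjective _
        Ideal.Quotient.mk_surjective hc).resolve_left ?_
      rw [Ideal.map_comap_of_surjective _ Ideal.Quotient.mk_surjective]
      exact hI.ne_top
    exact Ring.krullDimLE_iff.mp this
  refine localRingDepth_eq_ringKrullDim_of_le_one (x := algebraMap R _ f) ?_ ?_ ?_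
  · rw [IsLocalization.AtPrime.ringKrullDim_eq_height m (Localization.AtPrime m)]
    exact (Ideal.height_le_ringKrullDim_quotient_add_one hfm).trans
      (by simpa using add_le_add_left hzero 1)
  · exact (IsLocalization.AtPrime.to_map_mem_maximal_iff _ m f).mpr hfm
  · exact IsLocalization.map_nonZeroDivisors_le m.primeCompl _ (Submonoid.mem_map_of_mem _ hf)

/-! ### Invariance under ring isomorphism -/

open IsLocalRing in
theorem localRingDepth_le_of_ringEquiv {R S : Type*} [CommRing R] [CommRing S] [IsLocalRing R]
    [IsLocalRing S] (e : R ≃+* S) : localRingDepth R ≤ localRingDepth S := by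
  refine iSup₂_le fun rs h => ?_
  refine le_iSup₂_of_le (rs.map e) ⟨?_, ?_⟩ (by simp)
  · refine (AddEquiv.isRegular_congr (e := e.toAddEquiv) ?_).mp h.1
    exact List.forall₂_map_right_iff.mpr (List.forall₂_same.mpr fun r _ x => by simp)
  · simp only [List.mem_map, forall_exists_index, and_imp, forall_apply_eq_imp_iff₂]
    intro r hr
    simpa [mem_maximalIdeal, mem_nonunits_iff] using h.2 r hr

theorem localRingDepth_congr {R S : Type*} [CommRing R] [CommRing S] [IsLocalRing R]
    [IsLocalRing S] (e : R ≃+* S) : localRingDepth R = localRingDepth S :=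
  (localRingDepth_le_of_ringEquiv e).antisymm (localRingDepth_le_of_ringEquiv e.symm)

theorem IsCohenMacaulayRing.of_ringEquiv {R S : Type*} [CommRing R] [CommRing S] (e : R ≃+* S)
    (h : IsCohenMacaulayRing R) : IsCohenMacaulayRing S := by
  have := h.1
  refine ⟨isNoetherianRing_of_ringEquiv R e, fun m hm => ?_⟩
  have := Ideal.comap_isMaximal_of_equiv e (p := m)
  let e' := Localization.localRingEquiv (m.comap e) m e rfl
  rw [← localRingDepth_congr e', ← ringKrullDim_eq_of_ringEquiv e']
  exact h.2 _

/-! ### Monomials and coordinate axes -/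

namespace AbstractSimplicialComplex

/-- A polynomial lies in the Stanley–Reisner ideal iff the support of each of its monomials is
a nonempty non-face. -/
theorem mem_stanleyReisnerIdeal_iff {V k : Type*} [Field k] {Δ : AbstractSimplicialComplex V}
    {f : MvPolynomial V k} :
    f ∈ Δ.stanleyReisnerIdeal k ↔ ∀ d ∈ f.support, d.support.Nonempty ∧ d.support ∉ Δ.faces := by
  classical
  have hprod (s : Finset V) : (∏ x ∈ s, MvPolynomial.X x : MvPolynomial V k) =
      MvPolynomial.monomial (∑ x ∈ s, Finsupp.single x 1) 1 :=
    (MvPolynomial.monomial_sum_one s _).symm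
  have happly (s : Finset V) (v : V) :
      (∑ x ∈ s, Finsupp.single x 1 : V →₀ ℕ) v = if v ∈ s then 1 else 0 := by
    simp [Finsupp.finsetSum_apply, Finsupp.single_apply]
  have hspan : Δ.stanleyReisnerIdeal k = Ideal.span ((fun d => MvPolynomial.monomial d (1 : k)) ''
      {d | ∃ s : Finset V, s.Nonempty ∧ s ∉ Δ.faces ∧ d = ∑ x ∈ s, Finsupp.single x 1}) := by
    refine congrArg Ideal.span (Set.ext fun p => ⟨?_, ?_⟩)
    · rintro ⟨s, h₁, h₂, rfl⟩
      exact ⟨_, ⟨s, h₁, h₂, rfl⟩, (hprod s).symm⟩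
    · rintro ⟨_, ⟨s, h₁, h₂, rfl⟩, rfl⟩
      exact ⟨s, h₁, h₂, (hprod s).symm⟩
  rw [hspan, MvPolynomial.mem_ideal_span_monomial_image]
  -- In the converse, the squarefree monomial on `d.support` divides the monomial of `d`.
  refine forall₂_congr fun d _ => ⟨?_, fun ⟨h₁, h₂⟩ => ⟨_, ⟨d.support, h₁, h₂, rfl⟩, fun v => ?_⟩⟩
  · rintro ⟨_, ⟨s, hs, hns, rfl⟩, hle⟩
    have hsub : s ⊆ d.support := fun v hv => by
      have := hle v
      rw [happly, if_pos hv] at this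
      exact Finsupp.mem_support_iff.mpr (by omega)
    exact ⟨hs.mono hsub, fun hd => hns ((Δ.isRelLowerSet_faces hd).2 hsub hs)⟩
  · rw [happly]
    split_ifs with hv
    · exact Nat.one_le_iff_ne_zero.mpr (Finsupp.mem_support_iff.mp hv)
    · exact Nat.zero_le _

end AbstractSimplicialComplex

namespace MvPolynomial

variable {V k : Type*} [DecidableEq V] [Field k]

/-- Restriction of polynomial functions to a coordinate axis. -/
noncomputable def restrictAxis (k : Type*) [Field k] (i : V) :
    MvPolynomial V k →ₐ[k] Polynomial k :=
  aeval (Pi.single i Polynomial.X)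

theorem restrictAxis_X (i j : V) :
    restrictAxis k i (X j) = if j = i then Polynomial.X else 0 := by
  rw [restrictAxis, aeval_X, Pi.single_apply]

/-- A monomial involving a variable other than `X i` vanishes on the axis; powers of `X i` survive.
-/
theorem coeff_restrictAxis (i : V) (f : MvPolynomial V k) (e : ℕ) :
    (restrictAxis k i f).coeff e = f.coeff (Finsupp.single i e) := by
  induction f using MvPolynomial.induction_on' with
  | add p q hp hq => simp [hp, hq]
  | monomial d a =>
    rw [restrictAxis, aeval_monomial, coeff_monomial, Polynomial.algebraMap_eq,
      Polynomial.coeff_C_mul]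
    by_cases hd : ∃ n, d = Finsupp.single i n
    · obtain ⟨n, rfl⟩ := hd
      rw [Finsupp.prod_single_index (by simp), Pi.single_eq_same, Polynomial.coeff_X_pow]
      simp [(Finsupp.single_injective i).eq_iff, eq_comm]
    · rw [if_neg fun h => hd ⟨e, h⟩]
      obtain ⟨j, hj, hji⟩ : ∃ j ∈ d.support, j ≠ i := by
        by_contra! h
        exact hd ⟨d i, Finsupp.support_subset_singleton.mp fun j hj => by simp [h j hj]⟩
      rw [Finsupp.prod, Finset.prod_eq_zero hj]
      · simp
      · rw [Pi.single_eq_of_ne hji, zero_pow (Finsupp.mem_support_iff.mp hj)]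

end MvPolynomial

namespace SimpleGraph

open MvPolynomial

theorem mem_faces_independenceComplex_top_iff {V : Type*} {s : Finset V} :
    s ∈ (⊤ : SimpleGraph V).independenceComplex.faces ↔ ∃ v, s = {v} := by
  refine ⟨fun ⟨⟨v, hv⟩, h⟩ => ⟨v, Finset.eq_singleton_iff_unique_mem.mpr ⟨hv, fun w hw => ?_⟩⟩, ?_⟩
  · by_contra hne
    exact h hw hv hne hne
  · rintro ⟨v, rfl⟩
    exact (⊤ : SimpleGraph V).independenceComplex.singleton_mem v

/-- The Stanley–Reisner ideal of a complete graph is the vanishing ideal of the union of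
the coordinate axes. -/
theorem mem_stanleyReisnerIdeal_top_iff {V k : Type*} [DecidableEq V] [Nonempty V] [Field k]
    {f : MvPolynomial V k} :
    f ∈ (⊤ : SimpleGraph V).independenceComplex.stanleyReisnerIdeal k ↔
      ∀ i, restrictAxis k i f = 0 := by
  rw [AbstractSimplicialComplex.mem_stanleyReisnerIdeal_iff]
  simp only [mem_faces_independenceComplex_top_iff]
  refine ⟨fun h i => Polynomial.ext fun e => ?_, fun h d hd => ?_⟩
  · rw [coeff_restrictAxis, Polynomial.coeff_zero]
    by_contra hne
    obtain ⟨h₁, h₂⟩ := h _ (mem_support_iff.mpr hne)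
    rcases eq_or_ne e 0 with rfl | he
    · simp at h₁
    · exact h₂ ⟨i, Finsupp.support_single i he⟩
  · have hsingle (i : V) (n : ℕ) : d ≠ Finsupp.single i n := by
      rintro rfl
      rw [mem_support_iff, ← coeff_restrictAxis, h i] at hd
      exact hd (Polynomial.coeff_zero n)
    refine ⟨Finsupp.support_nonempty_iff.mpr ?_, fun ⟨i, hi⟩ => ?_⟩
    -- The constant term is seen on any axis, so one vertex is needed.
    · rintro rfl
      exact hsingle (Classical.arbitrary V) 0 (by simp)
    · exact hsingle i (d i) (Finsupp.support_subset_singleton.mp hi.subset)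

/-! ### Complete graphs via Noether normalization -/

section Top

variable (V k : Type*) [Fintype V] [Field k]

/-- The homomorphism from the univariate polynomial ring to the Stanley–Reisner ring of the
complete graph that sends the variable to the sum of the vertices. -/
noncomputable def topParameterHom : Polynomial k →+*
    (⊤ : SimpleGraph V).independenceComplex.StanleyReisnerRing k :=
  (Ideal.Quotient.mk _).comp (Polynomial.aeval (∑ i : V, (X i : MvPolynomial V k))).toRingHom

variable {V k}

theorem topParameterHom_apply (p : Polynomial k) : topParameterHom V k p =
    Ideal.Quotient.mk _ (Polynomial.aeval (∑ i : V, (X i : MvPolynomial V k)) p) := rfl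

/-- On every axis `∑ X i` restricts to the coordinate, so the image of `p` restricts to `p` itself,
and `k[t]` is a domain. -/
theorem topParameterHom_mem_nonZeroDivisors [Nonempty V] {p : Polynomial k} (hp : p ≠ 0) :
    topParameterHom V k p ∈ nonZeroDivisors _ := by
  classical
  rw [mem_nonZeroDivisors_iff_right]
  intro q hq
  obtain ⟨f, rfl⟩ := Ideal.Quotient.mk_surjective q
  rw [topParameterHom_apply, ← map_mul, Ideal.Quotient.eq_zero_iff_mem,
    mem_stanleyReisnerIdeal_top_iff] at hq
  rw [Ideal.Quotient.eq_zero_iff_mem, mem_stanleyReisnerIdeal_top_iff]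
  intro i
  have hi := hq i
  rw [map_mul, ← Polynomial.aeval_algHom_apply, map_sum] at hi
  simp only [restrictAxis_X, Finset.sum_ite_eq', Finset.mem_univ, if_true,
    Polynomial.aeval_X_left_apply] at hi
  exact (mul_eq_zero.mp hi).resolve_right hp

theorem topParameterHom_isIntegral [Nonempty V] : (topParameterHom V k).IsIntegral := by
  classical
  intro q
  obtain ⟨f, rfl⟩ := Ideal.Quotient.mk_surjective q
  induction f using MvPolynomial.induction_on with
  | C a =>
    convert (topParameterHom V k).isIntegralElem_map (x := Polynomial.C a) using 1
    rw [topParameterHom_apply, Polynomial.aeval_C]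
    rfl
  | add f g hf hg =>
    rw [map_add]
    exact hf.add _ hg
  | mul_X f i hf =>
    rw [map_mul]
    -- Distinct variables multiply to zero, so `X i ^ 2 = (∑ X j) * X i`.
    refine hf.mul _ ⟨Polynomial.X ^ 2 - Polynomial.C Polynomial.X * Polynomial.X, ?_, ?_⟩
    · monicity!
    · rw [Polynomial.eval₂_sub, Polynomial.eval₂_mul, Polynomial.eval₂_C, Polynomial.eval₂_X_pow,
        Polynomial.eval₂_X, topParameterHom_apply, Polynomial.aeval_X, ← map_pow, ← map_mul,
        ← map_sub, Ideal.Quotient.eq_zero_iff_mem, mem_stanleyReisnerIdeal_top_iff]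
      intro j
      simp only [map_sub, map_mul, map_pow, map_sum, restrictAxis_X, Finset.sum_ite_eq',
        Finset.mem_univ, if_true]
      split_ifs <;> ring

end Top

/-- Complete graphs are Cohen–Macaulay. -/
theorem isCohenMacaulay_top (V k : Type*) [Finite V] [Nonempty V] [Field k] :
    (⊤ : SimpleGraph V).IsCohenMacaulay k := by
  have := Fintype.ofFinite V
  refine IsCohenMacaulayRing.of_exists_nonZeroDivisor fun m hm => ?_
  have hmax := Ideal.isMaximal_comap_of_isIntegral_of_isMaximal' (topParameterHom V k)
    topParameterHom_isIntegral m
  -- The contraction of `m` is maximal in `k[t]`, hence nonzero since `k[t]` is not a field.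
  obtain ⟨p, hpm, hp⟩ := Submodule.exists_mem_ne_zero_of_ne_bot
    (Ring.ne_bot_of_isMaximal_of_not_isField hmax (Polynomial.not_isField k))
  refine ⟨_, hpm, topParameterHom_mem_nonZeroDivisors hp, fun P hP hpP => ?_⟩
  refine Ideal.isMaximal_of_isIntegral_of_isMaximal_comap' _ topParameterHom_isIntegral P ?_
  -- `P` contracts to a prime containing `p ≠ 0`, and nonzero primes of `k[t]` are maximal.
  exact Ideal.IsPrime.isMaximal inferInstance fun hbot =>
    hp ((Submodule.mem_bot _).mp (hbot ▸ Ideal.mem_comap.mpr hpP))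

/-! ### Graph isomorphisms and reduction to complete graphs -/

theorem Iso.mem_faces_independenceComplex_iff {V W : Type*} {G : SimpleGraph V}
    {G' : SimpleGraph W} (e : G ≃g G') {s : Finset V} :
    s.map e.toEquiv.toEmbedding ∈ G'.independenceComplex.faces ↔
      s ∈ G.independenceComplex.faces := by
  refine and_congr Finset.map_nonempty ?_
  rw [isIndepSet_iff, isIndepSet_iff, Finset.coe_map, Equiv.coe_toEmbedding,
    Set.InjOn.pairwise_image e.toEquiv.injective.injOn]
  exact forall₅_congr fun a _ b _ _ => not_congr e.map_adj_iff

theorem Iso.map_stanleyReisnerIdeal {V W : Type*} (k : Type*) [Field k] {G : SimpleGraph V}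
    {G' : SimpleGraph W} (e : G ≃g G') :
    (G.independenceComplex.stanleyReisnerIdeal k).map (renameEquiv k e.toEquiv).toRingEquiv =
      G'.independenceComplex.stanleyReisnerIdeal k := by
  have hprod (s : Finset V) : renameEquiv k e.toEquiv (∏ x ∈ s, X x) =
      ∏ x ∈ s.map e.toEquiv.toEmbedding, X x := by
    simp
  rw [AbstractSimplicialComplex.stanleyReisnerIdeal, Ideal.map_span]
  refine congrArg Ideal.span (Set.ext fun p => ⟨?_, ?_⟩)
  · rintro ⟨_, ⟨s, h₁, h₂, rfl⟩, rfl⟩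
    exact ⟨s.map e.toEquiv.toEmbedding, by simpa, e.mem_faces_independenceComplex_iff.not.mpr h₂,
      hprod s⟩
  · rintro ⟨s, h₁, h₂, rfl⟩
    obtain ⟨t, rfl⟩ : ∃ t : Finset V, t.map e.toEquiv.toEmbedding = s :=
      (Equiv.finsetCongr e.toEquiv).surjective s
    exact ⟨_, ⟨t, by simpa using h₁, e.mem_faces_independenceComplex_iff.not.mp h₂, rfl⟩, hprod t⟩

theorem IsCohenMacaulay.of_iso {V W k : Type*} [Field k] {G : SimpleGraph V}
    {G' : SimpleGraph W} (e : G ≃g G') (h : G.IsCohenMacaulay k) : G'.IsCohenMacaulay k :=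
  IsCohenMacaulayRing.of_ringEquiv
    (Ideal.quotientEquiv _ _ (renameEquiv k e.toEquiv).toRingEquiv
      (e.map_stanleyReisnerIdeal k).symm) h

theorem eq_top_of_indepNum_le_one {V : Type*} [Finite V] {G : SimpleGraph V}
    (h : G.indepNum ≤ 1) : G = ⊤ := by
  classical
  refine eq_top_iff.mpr fun a b hab => ?_
  by_contra hadj
  have hindep : G.IsIndepSet (({a, b} : Finset V) : Set V) := by
    rw [isIndepSet_iff, Finset.coe_pair, Set.pairwise_pair]
    exact fun _ => ⟨hadj, fun h => hadj h.symm⟩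
  have := hindep.card_le_indepNum
  rw [Finset.card_pair hab] at this
  omega

theorem indepNum_top_le_one {V : Type*} [Finite V] : (⊤ : SimpleGraph V).indepNum ≤ 1 := by
  obtain ⟨s, hs⟩ := (⊤ : SimpleGraph V).exists_isNIndepSet_indepNum
  rw [← hs.card_eq, Finset.card_le_one]
  intro a ha b hb
  by_contra hab
  exact hs.isIndepSet ha hb hab hab

theorem lexProduct_top {V : Type*} {W : V → Type*} :
    (⊤ : SimpleGraph V).lexProduct (fun x => (⊤ : SimpleGraph (W x))) = ⊤ := by
  refine eq_top_iff.mpr ?_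
  rintro ⟨x, a⟩ ⟨y, b⟩ hne
  by_cases h : x = y
  · subst h
    exact Or.inl ⟨rfl, fun hab => hne (congrArg _ hab)⟩
  · exact Or.inr h

/-- A lexicographic product over a single vertex is isomorphic to its only factor. -/
def isoLexProductOfUnique {V : Type*} [Unique V] {W : V → Type*} (G : SimpleGraph V)
    (H : ∀ x, SimpleGraph (W x)) : H default ≃g G.lexProduct H where
  toEquiv := (Equiv.uniqueSigma W).symm
  map_rel_iff' {a b} := by
    refine ⟨?_, fun h => Or.inl ⟨rfl, h⟩⟩
    rintro (⟨_, h⟩ | h)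
    · exact h
    · exact (G.irrefl h).elim

end SimpleGraph

theorem mainTheorem7 {V : Type*} [Finite V] [Nonempty V] (n : ℕ) (hn : Nat.card V = n)
    (G : SimpleGraph V) (hG : G = ⊤)
    {W : V → Type*} [∀ x, Finite (W x)] [∀ x, Nonempty (W x)] (H : ∀ x, SimpleGraph (W x))
    (k : Type*) [Field k]
    (hCM : ∀ x, (H x).IsCohenMacaulay k)
    (hshell : ∀ x, (H x).IsShellable)
    (hcomplete : n - 1 ≤ {x | H x = ⊤}.ncard)
    (hindep : ∀ x y, (H x).indepNum = (H y).indepNum) :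
    (G.lexProduct H).IsCohenMacaulay k := by
  rcases subsingleton_or_nontrivial V with hV | hV
  · let _ : Inhabited V := Classical.inhabited_of_nonempty inferInstance
    let _ := Unique.mk' V
    exact (hCM default).of_iso (SimpleGraph.isoLexProductOfUnique G H)
  · have hcard := Finite.one_lt_card (α := V)
    -- Here `n ≥ 2`, so `n - 1 ≥ 1` factors are complete.
    obtain ⟨x, hx⟩ : {x | H x = ⊤}.Nonempty :=
      Set.nonempty_of_ncard_ne_zero (by omega)
    have htop : H = fun y => ⊤ := funext fun y => SimpleGraph.eq_top_of_indepNum_le_one <| by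
      rw [hindep y x, show H x = ⊤ from hx]
      exact SimpleGraph.indepNum_top_le_one
    rw [hG, htop, SimpleGraph.lexProduct_top]
    have : Nonempty (Σ x, W x) := ⟨⟨x, Classical.arbitrary _⟩⟩
    exact SimpleGraph.isCohenMacaulay_top _ k
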